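/- **Conventions.** For a finite group $G$ and $S\subseteq G$ put $Q(S)=\{s_1s_2^{-1}:s_1,s_2\in S\}$. Subsets $S_1,S_2,S_3\subseteq G$ satisfy the *triple product property* if for $q_i\in Q(S_i)$ the equation $q_1q_2q_3=1$ implies $q_1=q_2=q_3=1$; if moreover $|S_1|=a$, $|S_2|=b$, $|S_3|=c$, then $G$ *realizes* $\langle a,b,c\rangle$. The *pseudo-exponent* $\alpha(G)$ of a non-trivial finite group $G$ is the minimum of $3\log|G|/\log(abc)$ over all positive integers $a,b,c$, not all $1$, such that $G$ realizes $\langle a,b,c\rangle$ (and $\alpha(G)=3$ if $G$ is trivial). The character degrees of $G$ are the dimensions of its irreducible complex representations. If $G$ is not abelian, $\gamma(G)$ is the real number such that $|G|^{1/\gamma(G)}$ is the largest character degree of $G$; if $G$ is abelian, $\gamma(G)=\infty$. For $n\ge 1$ let $A=\mathbb{Z}/2n\mathbb{Z}$ and let $G_n=A\wr S_n=S_n\ltimes A^n$, with multiplication $(\pi,x)(\pi',y)=(\pi\pi',\pi'x+y)$, where $(\pi x)_i=x_{\pi(i)}$. Let $u=(1,2,\dots,n)$ and $v=(n,n-1,\dots,1)$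 in $A^n$. **Theorem.** For every $n\ge 1$: 1. the sets $H_1=\{(\pi,0):\pi\in S_n\}$, $H_2=\{(\pi,\pi u-u):\pi\in S_n\}$ and $H_3=\{(\pi,\pi v-v):\pi\in S_n\}$ are subgroups of $G_n$ and satisfy the triple product property; 2. the largest character degree of $G_n$ is $n!$; 3. $\alpha(G_n)\le\gamma(G_n)$. Moreover there is a constant $C$ such that for all $n\ge 2$ the number $\gamma(G_n)$ is finite and $$\left|\gamma(G_n)-\left(2+\frac{1+\log 2}{\log n}\right)\right|\le\frac{C}{(\log n)^2},$$ that is, $\gamma(G_n)=2+\frac{1+\log 2}{\log n}+O\!\left(\frac{1}{(\log n)^2}\right)$. -/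

import Mathlib

open scoped Nat

noncomputable section

/-- The right quotient set `Q(S) = {s₁ s₂⁻¹ : s₁, s₂ ∈ S}`. -/
def rightQuotientSet {G : Type*} [Group G] (S : Set G) : Set G :=
  {q | ∃ s₁ ∈ S, ∃ s₂ ∈ S, q = s₁ * s₂⁻¹}

/-- The triple product property of three subsets of a group. -/
def TripleProductProperty {G : Type*} [Group G] (S₁ S₂ S₃ : Set G) : Prop :=
  ∀ q₁ ∈ rightQuotientSet S₁, ∀ q₂ ∈ rightQuotientSet S₂, ∀ q₃ ∈ rightQuotientSet S₃,
    q₁ * q₂ * q₃ = 1 → q₁ = 1 ∧ q₂ = 1 ∧ q₃ = 1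

/-- The group `G` realizes `⟨n, m, p⟩`. -/
def Realizes (G : Type*) [Group G] (n m p : ℕ) : Prop :=
  ∃ S₁ S₂ S₃ : Finset G, S₁.card = n ∧ S₂.card = m ∧ S₃.card = p ∧
    TripleProductProperty (S₁ : Set G) (S₂ : Set G) (S₃ : Set G)

/-- The values `3 log |G| / log (nmp)`, where `n, m, p` are positive integers, not all equal to `1`
(together this says `1 < n * m * p`), such that `G` realizes `⟨n, m, p⟩`. -/
def pseudoExponentValues (G : Type*) [Group G] : Set ℝ :=
  {x | ∃ n m p : ℕ, 1 < n * m * p ∧ Realizes G n m p ∧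
    x = 3 * Real.log (Nat.card G) / Real.log ((n * m * p : ℕ) : ℝ)}

open Classical in
/-- The pseudo-exponent `α(G)` of a finite group. The infimum is a minimum for a non-trivial finite
group, see `isLeast_pseudoExponent`. -/
def pseudoExponent (G : Type*) [Group G] : ℝ :=
  if Nontrivial G then sInf (pseudoExponentValues G) else 3

theorem isLeast_pseudoExponent (G : Type*) [Group G] [Finite G] [Nontrivial G] :
    IsLeast (pseudoExponentValues G) (pseudoExponent G) := by
  classical
  have : Fintype G := Fintype.ofFinite G
  rw [pseudoExponent, if_pos (inferInstanceAs (Nontrivial G))]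
  have hfin : (pseudoExponentValues G).Finite := by
    refine (Set.finite_range (fun s : Finset G × Finset G × Finset G =>
      3 * Real.log (Nat.card G) /
        Real.log ((s.1.card * s.2.1.card * s.2.2.card : ℕ) : ℝ))).subset ?_
    rintro x ⟨n, m, p, -, ⟨S₁, S₂, S₃, rfl, rfl, rfl, -⟩, rfl⟩
    exact ⟨(S₁, S₂, S₃), rfl⟩
  have hne : (pseudoExponentValues G).Nonempty := by
    refine ⟨_, 1, 1, Fintype.card G, ?_, ⟨{1}, {1}, Finset.univ, by simp, by simp, rfl, ?_⟩, rfl⟩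
    · simpa using Fintype.one_lt_card (α := G)
    · rintro q₁ ⟨a, ha, b, hb, rfl⟩ q₂ ⟨c, hc, d, hd, rfl⟩ q₃ - h
      simp only [Finset.coe_singleton, Set.mem_singleton_iff] at ha hb hc hd
      subst ha hb hc hd
      simpa using h
  exact ⟨hne.csInf_mem hfin, fun x hx => csInf_le hfin.bddBelow hx⟩

/-- The character degrees of `G`: the dimensions of its (finite-dimensional) irreducible complex
representations. -/
def characterDegrees (G : Type*) [Group G] : Set ℕ :=
  {d | ∃ (V : Type) (_ : AddCommGroup V) (_ : Module ℂ V) (ρ : Representation ℂ G V),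
    FiniteDimensional ℂ V ∧ ρ.IsIrreducible ∧ Module.finrank ℂ V = d}

/-- The largest character degree of a finite group. -/
def maxCharacterDegree (G : Type*) [Group G] : ℕ :=
  sSup (characterDegrees G)

open Classical in
/-- The parameter `γ(G)` of a finite group: `γ(G) = ∞` if `G` is abelian, and otherwise `γ(G)` is
the real number with `|G| ^ (1 / γ(G)) = d`, where `d > 1` is the largest character degree. -/
def gammaExponent (G : Type*) [Group G] : EReal :=
  if ∀ a b : G, a * b = b * a then ⊤
  else ((Real.log (Nat.card G) / Real.log (maxCharacterDegree G) : ℝ) : EReal)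

/-- The action of a permutation on vectors by permuting coordinates: `(π u)ᵢ = u_{π(i)}`. -/
def permuteCoords {A : Type*} {n : ℕ} (π : Equiv.Perm (Fin n)) (u : Fin n → A) : Fin n → A :=
  fun i => u (π i)

/-- The wreath product `A ≀ Sₙ`, i.e. the semidirect product `Sₙ ⋉ Aⁿ`, for a group `A` written
additively. -/
@[ext]
structure WreathProduct (A : Type*) (n : ℕ) where
  perm : Equiv.Perm (Fin n)
  vec : Fin n → A

namespace WreathProduct

variable {A : Type*} [AddGroup A] {n : ℕ}

/-- `(π, u) (π', v) = (π π', π' u + v)`. -/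
instance : Mul (WreathProduct A n) where
  mul g h := ⟨g.perm * h.perm, permuteCoords h.perm g.vec + h.vec⟩

instance : One (WreathProduct A n) where
  one := ⟨1, 0⟩

instance : Inv (WreathProduct A n) where
  inv g := ⟨g.perm⁻¹, permuteCoords g.perm⁻¹ (-g.vec)⟩

theorem mul_def (g h : WreathProduct A n) :
    g * h = ⟨g.perm * h.perm, permuteCoords h.perm g.vec + h.vec⟩ := rfl

theorem one_def : (1 : WreathProduct A n) = ⟨1, 0⟩ := rfl

theorem inv_def (g : WreathProduct A n) :
    g⁻¹ = ⟨g.perm⁻¹, permuteCoords g.perm⁻¹ (-g.vec)⟩ := rfl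

instance : Group (WreathProduct A n) :=
  Group.ofLeftAxioms
    (by
      intro a b c
      simp only [mul_def, WreathProduct.mk.injEq]
      refine ⟨mul_assoc _ _ _, ?_⟩
      funext i
      simp [permuteCoords, add_assoc])
    (by
      intro a
      simp only [mul_def, one_def]
      ext i <;> simp [permuteCoords])
    (by
      intro a
      simp only [mul_def, one_def, inv_def, WreathProduct.mk.injEq]
      refine ⟨inv_mul_cancel _, ?_⟩
      funext i
      simp [permuteCoords])

end WreathProduct

/-- The group `Gₙ = C_{2n} ≀ Sₙ`, for `n ≥ 1`. -/
abbrev wreathGroup (n : ℕ) : Type := WreathProduct (ZMod (2 * n)) n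

/-- The vector `u = (1, 2, …, n)` (the index `i : Fin n` runs from `0` to `n - 1`). -/
def ascendingVec (n : ℕ) : Fin n → ZMod (2 * n) := fun i => ((i : ℕ) : ZMod (2 * n)) + 1

/-- The vector `v = (n, n - 1, …, 1)`. -/
def descendingVec (n : ℕ) : Fin n → ZMod (2 * n) :=
  fun i => (n : ZMod (2 * n)) - ((i : ℕ) : ZMod (2 * n))

end

/-! The three sets are conjugates of the complement `Sₙ`, so each equals its own quotient set.
Reading a relation `q₁ q₂ q₃ = 1` coordinatewise gives `σ k + τ k = 2 k` modulo `2n` for two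
permutations. Both sides lie below `2n`, so this holds in the integers, and comparing sums of
squares forces `σ = τ = 1` (`eq_one_of_add_eq_two_mul`).

The degrees come from Clifford theory for the abelian normal subgroup `Aⁿ`. An irreducible
representation contains a common eigenvector of `Aⁿ`, whose `n!` translates under `Sₙ` span it.
Conversely, inducing a character of `Aⁿ` with pairwise distinct conjugates gives an irreducible
representation of dimension `n!`.

Since the subgroups also have order `n!`, for `n ≥ 2` both parts lead to `log |G| / log n!`, as an
upper bound for `α` and as the value of `γ`. The expansion follows from `|G| = n! (2n)ⁿ` and `log n!
= n (log n - 1 + ε)` with `ε = O(log n / n)`. -/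

/-! ### The three subgroups and the triple product property -/

/-- The conjugate `{(π, π u - u)}` of the complement `Sₙ` of `Aⁿ` in `A ≀ Sₙ`. -/
def WreathProduct.conjPerm {A : Type*} [AddCommGroup A] {n : ℕ} (u : Fin n → A) :
    Subgroup (WreathProduct A n) where
  carrier := {g | ∃ π : Equiv.Perm (Fin n), g = ⟨π, permuteCoords π u - u⟩}
  one_mem' := ⟨1, by ext i <;> simp [WreathProduct.one_def, permuteCoords]⟩
  mul_mem' := by
    rintro _ _ ⟨π, rfl⟩ ⟨σ, rfl⟩
    refine ⟨π * σ, ?_⟩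
    simp only [WreathProduct.mul_def, WreathProduct.mk.injEq, true_and]
    funext i
    simp [permuteCoords]
  inv_mem' := by
    rintro _ ⟨π, rfl⟩
    refine ⟨π⁻¹, ?_⟩
    simp only [WreathProduct.inv_def, WreathProduct.mk.injEq, true_and]
    funext i
    simp [permuteCoords]

theorem WreathProduct.coe_conjPerm {A : Type*} [AddCommGroup A] {n : ℕ} (u : Fin n → A) :
    (WreathProduct.conjPerm u : Set (WreathProduct A n)) =
      {g | ∃ π : Equiv.Perm (Fin n), g = ⟨π, permuteCoords π u - u⟩} := rfl

theorem rightQuotientSet_subgroup {G : Type*} [Group G] (H : Subgroup G) :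
    rightQuotientSet (H : Set G) = H := by
  ext q
  constructor
  · rintro ⟨a, ha, b, hb, rfl⟩
    exact H.mul_mem ha (H.inv_mem hb)
  · intro hq
    exact ⟨q, hq, 1, H.one_mem, by simp⟩

/-- Two permutations whose pointwise average is the identity are trivial. -/
theorem eq_one_of_add_eq_two_mul {n : ℕ} (σ τ : Equiv.Perm (Fin n))
    (h : ∀ k, ((σ k : ℕ) : ℤ) + (τ k : ℕ) = 2 * (k : ℕ)) : σ = 1 ∧ τ = 1 := by
  have hσ : ∑ k, (((σ k : ℕ) : ℤ)) ^ 2 = ∑ k : Fin n, ((k : ℕ) : ℤ) ^ 2 :=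
    Equiv.sum_comp σ (fun k : Fin n => ((k : ℕ) : ℤ) ^ 2)
  have hτ : ∑ k, (((τ k : ℕ) : ℤ)) ^ 2 = ∑ k : Fin n, ((k : ℕ) : ℤ) ^ 2 :=
    Equiv.sum_comp τ (fun k : Fin n => ((k : ℕ) : ℤ) ^ 2)
  -- Parallelogram law: `(s - t)² = 2s² + 2t² - (s + t)²` with `s + t = 2k`. The sum vanishes
  -- because permuting the indices preserves the sum of squares.
  have key : ∑ k, (((σ k : ℕ) : ℤ) - (τ k : ℕ)) ^ 2 = 0 := by
    have : ∀ k, (((σ k : ℕ) : ℤ) - (τ k : ℕ)) ^ 2 =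
        2 * ((σ k : ℕ) : ℤ) ^ 2 + 2 * ((τ k : ℕ) : ℤ) ^ 2 - 4 * ((k : ℕ) : ℤ) ^ 2 := by
      intro k
      linear_combination (-(((σ k : ℕ) : ℤ) + (τ k : ℕ)) - 2 * (k : ℕ)) * h k
    simp only [this, Finset.sum_sub_distrib, Finset.sum_add_distrib, ← Finset.mul_sum, hσ, hτ]
    ring
  rw [Finset.sum_eq_zero_iff_of_nonneg fun _ _ => sq_nonneg _] at key
  have e : ∀ k, σ k = k ∧ τ k = k := by
    intro k
    have h1 := h k
    have h2 : ((σ k : ℕ) : ℤ) - (τ k : ℕ) = 0 := by simpa using key k (Finset.mem_univ k)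
    constructor <;> (apply Fin.ext; omega)
  exact ⟨Equiv.ext fun k => (e k).1, Equiv.ext fun k => (e k).2⟩

theorem tripleProductProperty_conjPerm (n : ℕ) :
    TripleProductProperty (WreathProduct.conjPerm (0 : Fin n → ZMod (2 * n)) : Set (wreathGroup n))
      (WreathProduct.conjPerm (ascendingVec n)) (WreathProduct.conjPerm (descendingVec n)) := by
  intro q₁ h₁ q₂ h₂ q₃ h₃ h
  rw [rightQuotientSet_subgroup] at h₁ h₂ h₃
  obtain ⟨π₁, rfl⟩ := h₁
  obtain ⟨π₂, rfl⟩ := h₂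
  obtain ⟨π₃, rfl⟩ := h₃
  simp only [WreathProduct.mul_def, WreathProduct.one_def, WreathProduct.mk.injEq] at h
  obtain ⟨hπ, hv⟩ := h
  have hk : ∀ k, (((π₂ k : ℕ) : ℤ)) + ((π₃⁻¹ k : Fin n) : ℕ) = 2 * (k : ℕ) := by
    intro k
    have hinv : π₃ (π₃⁻¹ k) = k := by simp
    have h1 := congrFun hv (π₃⁻¹ k)
    simp only [permuteCoords, ascendingVec, descendingVec, Pi.add_apply, Pi.sub_apply,
      Pi.zero_apply, hinv] at h1
    have h2 : (((π₂ k : ℕ) + ((π₃⁻¹ k : Fin n) : ℕ) : ℕ) : ZMod (2 * n)) =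
        ((2 * (k : ℕ) : ℕ) : ZMod (2 * n)) := by
      push_cast
      linear_combination h1
    -- Both sides are at most `2n - 2`, so modulus `2n` leaves no room for wraparound.
    rw [ZMod.natCast_eq_natCast_iff, Nat.ModEq, Nat.mod_eq_of_lt, Nat.mod_eq_of_lt] at h2
    · exact_mod_cast h2
    · have := k.2; omega
    · have := (π₂ k).2; have := (π₃⁻¹ k).2; omega
  obtain ⟨rfl, h3⟩ := eq_one_of_add_eq_two_mul π₂ π₃⁻¹ hk
  obtain rfl : π₃ = 1 := by simpa using h3
  obtain rfl : π₁ = 1 := by simpa using hπ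
  refine ⟨?_, ?_, ?_⟩ <;> ext i <;> simp [WreathProduct.one_def, permuteCoords]

theorem realizes_factorial (n : ℕ) : Realizes (wreathGroup n) n ! n ! n ! := by
  let f (u : Fin n → ZMod (2 * n)) : Equiv.Perm (Fin n) ↪ wreathGroup n :=
    ⟨fun π => ⟨π, permuteCoords π u - u⟩, fun _ _ h => (WreathProduct.mk.inj h).1⟩
  have hf (u) : ((Finset.univ.map (f u) : Finset (wreathGroup n)) : Set (wreathGroup n)) =
      WreathProduct.conjPerm u := by
    ext g
    simp only [Finset.coe_map, Finset.coe_univ, Set.image_univ, WreathProduct.coe_conjPerm]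
    exact ⟨fun ⟨π, h⟩ => ⟨π, h.symm⟩, fun ⟨π, h⟩ => ⟨π, h.symm⟩⟩
  refine ⟨Finset.univ.map (f 0), Finset.univ.map (f (ascendingVec n)),
    Finset.univ.map (f (descendingVec n)), ?_, ?_, ?_, ?_⟩
  · simp [Fintype.card_perm]
  · simp [Fintype.card_perm]
  · simp [Fintype.card_perm]
  · simp only [hf]
    exact tripleProductProperty_conjPerm n

/-! ### Order, non-commutativity and the bound on the pseudo-exponent -/

/-- The underlying set of `A ≀ Sₙ` is a product. -/
def WreathProduct.equivProd (A : Type*) (n : ℕ) :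
    WreathProduct A n ≃ Equiv.Perm (Fin n) × (Fin n → A) where
  toFun g := (g.perm, g.vec)
  invFun p := ⟨p.1, p.2⟩

instance (A : Type*) [Finite A] (n : ℕ) : Finite (WreathProduct A n) :=
  Finite.of_equiv _ (WreathProduct.equivProd A n).symm

theorem card_wreathGroup (n : ℕ) : Nat.card (wreathGroup n) = n ! * (2 * n) ^ n := by
  rw [Nat.card_congr (WreathProduct.equivProd _ n), Nat.card_prod, Nat.card_fun]
  simp [Nat.card_eq_fintype_card, Fintype.card_perm]

theorem wreathGroup_not_comm {n : ℕ} (hn : 2 ≤ n) :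
    ¬ ∀ a b : wreathGroup n, a * b = b * a := by
  intro h
  have : Fact (1 < 2 * n) := ⟨by omega⟩
  let i : Fin n := ⟨0, by omega⟩
  let j : Fin n := ⟨1, by omega⟩
  have hij : j ≠ i := by simp [i, j]
  have h1 := congrFun (congrArg WreathProduct.vec (h ⟨1, Pi.single i 1⟩ ⟨Equiv.swap i j, 0⟩)) j
  simp [WreathProduct.mul_def, permuteCoords, hij] at h1

/-- Taking all three sizes equal to `n!` cancels the factor 3. For `n ≥ 2` the product of the sizes
exceeds 1, so this triple is admissible. -/
theorem pseudoExponent_wreathGroup_le {n : ℕ} (hn : 2 ≤ n) :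
    pseudoExponent (wreathGroup n) ≤ Real.log (Nat.card (wreathGroup n)) / Real.log (n ! : ℝ) := by
  have hf : 2 ≤ n ! := by simpa using Nat.factorial_le hn
  have : NeZero (2 * n) := ⟨by omega⟩
  have : Nontrivial (wreathGroup n) := by
    by_contra hs
    rw [not_nontrivial_iff_subsingleton] at hs
    exact wreathGroup_not_comm hn fun a b => Subsingleton.elim _ _
  refine (isLeast_pseudoExponent (wreathGroup n)).2 ⟨n !, n !, n !, ?_,
    realizes_factorial n, ?_⟩
  · calc 1 < 2 * 2 * 2 := by norm_num
      _ ≤ n ! * n ! * n ! := by gcongr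
  · have h0 : (n ! : ℝ) * n ! * n ! = (n ! : ℝ) ^ 3 := by ring
    push_cast
    rw [h0, Real.log_pow]
    push_cast
    rw [mul_div_mul_left _ _ (by norm_num)]

/-! ### Irreducible representations of the wreath product -/

section
variable {A : Type*} [AddCommGroup A] {n : ℕ}

/-- The representation of `A ≀ Sₙ` induced from a character of `Aⁿ`. -/
def inducedRep (χ : AddChar (Fin n → A) ℂ) :
    Representation ℂ (WreathProduct A n) (Equiv.Perm (Fin n) → ℂ) where
  toFun g :=
    { toFun := fun f τ => χ (permuteCoords (g.perm⁻¹ * τ) g.vec) * f (g.perm⁻¹ * τ)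
      map_add' := fun f f' => by ext τ; simp [mul_add]
      map_smul' := fun c f => by ext τ; simp [mul_left_comm] }
  map_one' := by
    ext f τ
    have : permuteCoords τ (0 : Fin n → A) = 0 := rfl
    simp [WreathProduct.one_def, this]
  map_mul' g h := by
    refine LinearMap.ext fun f => funext fun τ => ?_
    have : permuteCoords ((g.perm * h.perm)⁻¹ * τ) (permuteCoords h.perm g.vec + h.vec) =
        permuteCoords (g.perm⁻¹ * τ) g.vec + permuteCoords (h.perm⁻¹ * (g.perm⁻¹ * τ)) h.vec := by
      funext i
      simp [permuteCoords]
    change χ (permuteCoords ((g.perm * h.perm)⁻¹ * τ) (permuteCoords h.perm g.vec + h.vec)) *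
      f ((g.perm * h.perm)⁻¹ * τ) = χ (permuteCoords (g.perm⁻¹ * τ) g.vec) *
        (χ (permuteCoords (h.perm⁻¹ * (g.perm⁻¹ * τ)) h.vec) * f (h.perm⁻¹ * (g.perm⁻¹ * τ)))
    rw [this, AddChar.map_add_eq_mul, mul_inv_rev, mul_assoc, mul_assoc]

theorem inducedRep_apply (χ : AddChar (Fin n → A) ℂ) (g : WreathProduct A n)
    (f : Equiv.Perm (Fin n) → ℂ) (τ : Equiv.Perm (Fin n)) :
    inducedRep χ g f τ = χ (permuteCoords (g.perm⁻¹ * τ) g.vec) * f (g.perm⁻¹ * τ) := rfl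

/-- The conjugate of a character of `Aⁿ` by a permutation. -/
def AddChar.permuted (χ : AddChar (Fin n → A) ℂ) (σ : Equiv.Perm (Fin n)) :
    AddChar (Fin n → A) ℂ where
  toFun x := χ (permuteCoords σ x)
  map_zero_eq_one' := χ.map_zero_eq_one
  map_add_eq_mul' x y := χ.map_add_eq_mul (permuteCoords σ x) (permuteCoords σ y)

theorem AddChar.permuted_apply (χ : AddChar (Fin n → A) ℂ) (σ : Equiv.Perm (Fin n))
    (x : Fin n → A) : χ.permuted σ x = χ (permuteCoords σ x) := rfl

/-- An induced representation of `A ≀ Sₙ` is irreducible if the conjugates of the inducing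
character are distinct. -/
theorem inducedRep_isIrreducible [Finite A] (χ : AddChar (Fin n → A) ℂ)
    (hχ : Function.Injective χ.permuted) : (inducedRep χ).IsIrreducible := by
  classical
  have : Fintype A := Fintype.ofFinite A
  have key : ∀ W : Subrepresentation (inducedRep χ), ∀ f ∈ W.toSubmodule, f ≠ 0 →
      W.toSubmodule = ⊤ := by
    intro W f hf hf0
    obtain ⟨σ, hσ⟩ := Function.ne_iff.mp hf0
    have hσ' : Pi.single σ (1 : ℂ) ∈ W.toSubmodule := by
      -- Twisted averaging over `Aⁿ` projects onto the `χ.permuted σ`-eigenspace. As the conjugates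
      -- are distinct, orthogonality of characters kills every coordinate but `σ`.
      have hs : ∑ x : Fin n → A, χ.permuted σ (-x) • inducedRep χ ⟨1, x⟩ f ∈ W.toSubmodule :=
        W.toSubmodule.sum_mem fun x _ =>
          W.toSubmodule.smul_mem _ (W.apply_mem_toSubmodule _ hf)
      have he : ∑ x : Fin n → A, χ.permuted σ (-x) • inducedRep χ ⟨1, x⟩ f =
          ((Fintype.card (Fin n → A) : ℂ) * f σ) • Pi.single σ (1 : ℂ) := by
        funext τ
        have : ∑ x : Fin n → A, (χ.permuted τ * (χ.permuted σ)⁻¹) x =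
            if τ = σ then (Fintype.card (Fin n → A) : ℂ) else 0 := by
          rw [AddChar.sum_eq_ite]
          refine if_congr ?_ rfl rfl
          rw [← hχ.eq_iff]
          exact mul_inv_eq_one
        simp only [Finset.sum_apply, Pi.smul_apply, inducedRep_apply, smul_eq_mul, inv_one, one_mul]
        have h2 : ∀ x, χ.permuted σ (-x) * (χ (permuteCoords τ x) * f τ) =
            (χ.permuted τ * (χ.permuted σ)⁻¹) x * f τ := by
          intro x
          rw [AddChar.mul_apply, AddChar.inv_apply, AddChar.permuted_apply χ τ]
          ring
        simp only [h2, ← Finset.sum_mul, this]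
        by_cases h : τ = σ
        · subst h; simp
        · simp [h]
      rw [he] at hs
      refine (Submodule.smul_mem_iff _ (mul_ne_zero ?_ hσ)).mp hs
      exact_mod_cast Fintype.card_ne_zero
    -- The permutations act transitively on the point masses, so one of them yields the whole basis.
    have hτ : ∀ τ, Pi.single τ (1 : ℂ) ∈ W.toSubmodule := by
      intro τ
      have h := W.apply_mem_toSubmodule ⟨τ * σ⁻¹, 0⟩ hσ'
      convert h using 1
      funext ρ
      have h0 : ∀ π, permuteCoords π (0 : Fin n → A) = 0 := fun _ => rfl
      simp only [inducedRep_apply, h0, AddChar.map_zero_eq_one, one_mul, Pi.single_apply]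
      refine if_congr ?_ rfl rfl
      rw [inv_mul_eq_iff_eq_mul, inv_mul_cancel_right]
    rw [eq_top_iff]
    intro f' _
    rw [pi_eq_sum_univ' f']
    exact W.toSubmodule.sum_mem fun τ _ => W.toSubmodule.smul_mem _ (by
      convert hτ τ using 1)
  refine @IsSimpleOrder.mk _ _ _ ?_ ?_
  · refine ⟨⊥, ⊤, fun h => ?_⟩
    have h1 : (fun _ => 1 : Equiv.Perm (Fin n) → ℂ) ∈ (⊤ : Subrepresentation (inducedRep χ)) :=
      trivial
    rw [← h] at h1
    have h2 : (fun _ => 1 : Equiv.Perm (Fin n) → ℂ) = 0 := h1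
    exact one_ne_zero (congrFun h2 1)
  · intro W
    by_cases h : W.toSubmodule = ⊥
    · left
      exact Subrepresentation.toSubmodule_injective h
    · right
      obtain ⟨f, hf, hf0⟩ := Submodule.exists_mem_ne_zero_of_ne_bot h
      exact Subrepresentation.toSubmodule_injective (key W f hf hf0)

/-- A nontrivial representation of `A ≀ Sₙ` contains a common eigenvector of `Aⁿ`. -/
theorem exists_eigenvector_of_nontrivial [Finite A] {V : Type*} [AddCommGroup V] [Module ℂ V]
    [Nontrivial V] (ρ : Representation ℂ (WreathProduct A n) V) :
    ∃ v : V, v ≠ 0 ∧ ∃ χ : AddChar (Fin n → A) ℂ, ∀ x, ρ ⟨1, x⟩ v = χ x • v := by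
  classical
  have : Fintype A := Fintype.ofFinite A
  obtain ⟨w, hw⟩ := exists_ne (0 : V)
  -- Up to a scalar, the inner sums are the projections of `w` to the eigenspaces of `Aⁿ`. They add
  -- up to a nonzero multiple of `w`, so one of them is a nonzero eigenvector.
  have hsum : ∑ χ : AddChar (Fin n → A) ℂ, ∑ x, χ (-x) • ρ ⟨1, x⟩ w =
      (Fintype.card (Fin n → A) : ℂ) • w := by
    rw [Finset.sum_comm]
    have h1 : (⟨1, 0⟩ : WreathProduct A n) = 1 := rfl
    simp only [← Finset.sum_smul, AddChar.sum_apply_eq_ite, neg_eq_zero, ite_smul, zero_smul,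
      Finset.sum_ite_eq', Finset.mem_univ, if_true, h1, map_one, Module.End.one_apply]
  have hne : ∑ χ : AddChar (Fin n → A) ℂ, ∑ x, χ (-x) • ρ ⟨1, x⟩ w ≠ 0 := by
    rw [hsum]
    exact smul_ne_zero (by exact_mod_cast Fintype.card_ne_zero) hw
  obtain ⟨χ, -, hv⟩ := Finset.exists_ne_zero_of_sum_ne_zero hne
  refine ⟨_, hv, χ, fun y => ?_⟩
  rw [map_sum, Finset.smul_sum]
  refine Fintype.sum_equiv (Equiv.addLeft y) _ _ fun x => ?_
  have hm : (⟨1, y⟩ : WreathProduct A n) * ⟨1, x⟩ = ⟨1, y + x⟩ := by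
    have : permuteCoords 1 y = y := rfl
    simp [WreathProduct.mul_def, this]
  rw [map_smul, ← Module.End.mul_apply, ← map_mul, hm, smul_smul, Equiv.coe_addLeft,
    ← AddChar.map_add_eq_mul]
  rw [show y + -(y + x) = -x by abel]

/-- Irreducible representations of `A ≀ Sₙ` have dimension at most `n!`. -/
theorem finrank_le_factorial [Finite A] {V : Type*} [AddCommGroup V] [Module ℂ V]
    (ρ : Representation ℂ (WreathProduct A n) V) (hρ : ρ.IsIrreducible) :
    Module.finrank ℂ V ≤ n ! := by
  have : Nontrivial V := by
    by_contra hs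
    rw [not_nontrivial_iff_subsingleton] at hs
    obtain ⟨W, W', hW⟩ := hρ.exists_pair_ne
    exact hW (Subrepresentation.toSubmodule_injective (Subsingleton.elim _ _))
  obtain ⟨v, hv, χ, hχ⟩ := exists_eigenvector_of_nontrivial ρ
  let b : Equiv.Perm (Fin n) → V := fun π => ρ ⟨π, 0⟩ v
  have hstable : ∀ g, ∀ ⦃w⦄, w ∈ Submodule.span ℂ (Set.range b) →
      ρ g w ∈ Submodule.span ℂ (Set.range b) := by
    intro g w hw
    induction hw using Submodule.span_induction with
    | mem w hw =>
      obtain ⟨π, rfl⟩ := hw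
      -- Moving the vector part to the right of the permutation lets it act on `v` by a scalar, so
      -- the span of the translates is stable.
      have h : g * ⟨π, 0⟩ =
          (⟨g.perm * π, 0⟩ : WreathProduct A n) * ⟨1, permuteCoords π g.vec⟩ := by
        simp only [WreathProduct.mul_def, mul_one, WreathProduct.mk.injEq, true_and]
        funext i
        simp [permuteCoords]
      have : ρ g (b π) = χ (permuteCoords π g.vec) • b (g.perm * π) := by
        rw [← Module.End.mul_apply, ← map_mul, h, map_mul, Module.End.mul_apply, hχ, map_smul]
      rw [this]
      exact Submodule.smul_mem _ _ (Submodule.subset_span ⟨_, rfl⟩)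
    | zero => simp
    | add x y _ _ hx hy => rw [map_add]; exact Submodule.add_mem _ hx hy
    | smul c x _ hx => rw [map_smul]; exact Submodule.smul_mem _ c hx
  let W : Subrepresentation ρ := ⟨Submodule.span ℂ (Set.range b), hstable⟩
  have hvW : v ∈ W.toSubmodule := Submodule.subset_span ⟨1, by
    change ρ 1 v = v
    simp⟩
  have hW : W.toSubmodule = ⊤ := by
    rcases hρ.eq_bot_or_eq_top W with h | h
    · rw [h] at hvW
      exact absurd hvW hv
    · rw [h]; rfl
  calc Module.finrank ℂ V = Module.finrank ℂ (Submodule.span ℂ (Set.range b)) := by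
        rw [← finrank_top ℂ V, ← hW]
    _ ≤ Fintype.card (Equiv.Perm (Fin n)) := finrank_range_le_card b
    _ = n ! := by rw [Fintype.card_perm, Fintype.card_fin]

end

theorem ascendingVec_injective {n : ℕ} : Function.Injective (ascendingVec n) := by
  intro i j h
  have h1 : (((i : ℕ) : ℕ) : ZMod (2 * n)) = ((j : ℕ) : ZMod (2 * n)) := by
    simpa [ascendingVec] using h
  rw [ZMod.natCast_eq_natCast_iff, Nat.ModEq, Nat.mod_eq_of_lt, Nat.mod_eq_of_lt] at h1
  · exact Fin.ext h1
  · have := j.2; omega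
  · have := i.2; omega

/-- A character of `(ℤ/N)ⁿ` with coordinates given by the vector `c`. -/
noncomputable def coordChar {N n : ℕ} [NeZero N] (c : Fin n → ZMod N) : AddChar (Fin n → ZMod N) ℂ where
  toFun x := ZMod.stdAddChar (∑ i, c i * x i)
  map_zero_eq_one' := by simp
  map_add_eq_mul' x y := by
    simp [mul_add, Finset.sum_add_distrib, AddChar.map_add_eq_mul]

/-- The value at the `j`-th basis vector determines `c (σ⁻¹ j)`, hence `σ⁻¹ j`, because the standard
additive character and `c` are injective. -/
theorem coordChar_permuted_injective {N n : ℕ} [NeZero N] {c : Fin n → ZMod N}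
    (hc : Function.Injective c) : Function.Injective (coordChar c).permuted := by
  intro σ τ h
  have key : ∀ (σ : Equiv.Perm (Fin n)) j,
      (coordChar c).permuted σ (Pi.single j 1) = ZMod.stdAddChar (c (σ⁻¹ j)) := by
    intro σ j
    change ZMod.stdAddChar (∑ i, c i * (Pi.single j 1 : Fin n → ZMod N) (σ i)) = _
    congr 1
    rw [Finset.sum_eq_single (σ⁻¹ j)]
    · simp
    · intro i _ hi
      have : σ i ≠ j := fun h => hi (by simp [← h])
      simp [this]
    · simp
  refine inv_injective (Equiv.ext fun j => hc (ZMod.injective_stdAddChar ?_))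
  rw [← key, ← key, h]

theorem isGreatest_characterDegrees {n : ℕ} (hn : 1 ≤ n) :
    IsGreatest (characterDegrees (wreathGroup n)) n ! := by
  have : NeZero (2 * n) := ⟨by omega⟩
  constructor
  · refine ⟨Equiv.Perm (Fin n) → ℂ, _, _, inducedRep (coordChar (ascendingVec n)),
      inferInstance, ?_, ?_⟩
    · exact inducedRep_isIrreducible _ (coordChar_permuted_injective ascendingVec_injective)
    · rw [Module.finrank_fintype_fun_eq_card, Fintype.card_perm, Fintype.card_fin]
  · rintro d ⟨V, _, _, ρ, -, hρ, rfl⟩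
    exact finrank_le_factorial ρ hρ

/-! ### Factorial estimates and the asymptotic expansion -/

/-- The term `nⁿ / n!` of the exponential series is at most `eⁿ`. -/
theorem le_log_factorial {n : ℕ} (hn : 1 ≤ n) :
    n * Real.log n - n ≤ Real.log (n ! : ℝ) := by
  have hn0 : (0 : ℝ) < n := by exact_mod_cast hn
  have h := Real.pow_div_factorial_le_exp (n : ℝ) hn0.le n
  have h2 := Real.log_le_log (by positivity) h
  rw [Real.log_exp, Real.log_div (by positivity) (by positivity), Real.log_pow] at h2
  linarith

/-- Induction; the step reduces to `(n + 1) log ((n + 1) / n) ≥ 1`. -/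
theorem log_factorial_le {n : ℕ} (hn : 1 ≤ n) :
    Real.log (n ! : ℝ) ≤ n * Real.log n - n + Real.log n + 1 := by
  induction n, hn using Nat.le_induction with
  | base => simp
  | succ n hn ih =>
    have hn0 : (0 : ℝ) < n := by exact_mod_cast hn
    have h := Real.one_sub_inv_le_log_of_pos (x := ((n : ℝ) + 1) / n) (by positivity)
    rw [Real.log_div (by positivity) (by positivity), inv_div] at h
    have h1 : (1 : ℝ) ≤ (n + 1) * (Real.log (n + 1) - Real.log n) := by
      calc (1 : ℝ) = (n + 1) * (1 - n / (n + 1)) := by field_simp; ring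
        _ ≤ _ := by gcongr
    rw [Nat.factorial_succ]
    push_cast
    rw [Real.log_mul (by positivity) (by positivity)]
    nlinarith

/-- Pair the factors `i + 1` and `n - i` of two copies of `n!`; each product is at least `n`. -/
theorem pow_self_le_factorial_sq (n : ℕ) : n ^ n ≤ n ! ^ 2 := by
  have h1 : n ! = ∏ i ∈ Finset.range n, (i + 1) := (Finset.prod_range_add_one_eq_factorial n).symm
  have h2 : n ! = ∏ i ∈ Finset.range n, (n - 1 - i + 1) := by
    rw [h1, Finset.prod_range_reflect (fun i => i + 1)]
  calc n ^ n = ∏ i ∈ Finset.range n, n := by simp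
    _ ≤ ∏ i ∈ Finset.range n, ((i + 1) * (n - 1 - i + 1)) := by
        refine Finset.prod_le_prod' fun i hi => ?_
        have hi : i < n := Finset.mem_range.mp hi
        obtain ⟨k, rfl⟩ : ∃ k, n = i + 1 + k := ⟨n - (i + 1), by omega⟩
        have : i + 1 + k - 1 - i = k := by omega
        rw [this]
        nlinarith [Nat.zero_le (i * k)]
    _ = n ! ^ 2 := by rw [Finset.prod_mul_distrib, ← h1, ← h2, sq]

/-- Keeps the denominator in the expansion at least a multiple of `log n` for all `n ≥ 2`; the
Stirling-type bound alone is negative at `n = 2`. -/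
theorem half_mul_log_le_log_factorial {n : ℕ} (hn : 1 ≤ n) :
    n * Real.log n / 2 ≤ Real.log (n ! : ℝ) := by
  have h : ((n : ℝ)) ^ n ≤ (n ! : ℝ) ^ 2 := by exact_mod_cast pow_self_le_factorial_sq n
  have hn0 : (0 : ℝ) < n := by exact_mod_cast hn
  have h2 := Real.log_le_log (by positivity) h
  rw [Real.log_pow, Real.log_pow] at h2
  push_cast at h2
  linarith

theorem log_sq_le_four_mul {x : ℝ} (hx : 1 ≤ x) : Real.log x ^ 2 ≤ 4 * x := by
  have h0 : 0 < x := by linarith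
  have h1 : Real.log x = 2 * Real.log (√x) := by rw [Real.log_sqrt h0.le]; ring
  have h2 : Real.log (√x) ≤ √x := Real.log_le_self (Real.sqrt_nonneg x)
  have h3 : 0 ≤ Real.log (√x) := Real.log_nonneg (Real.one_le_sqrt.mpr hx)
  have h4 := Real.sq_sqrt h0.le
  rw [h1]
  nlinarith

/-- The asymptotic expansion of `log |C_{2n} ≀ Sₙ| / log n!`. -/
theorem abs_log_div_log_factorial_sub_le {n : ℕ} (hn : 2 ≤ n) :
    |(Real.log (n ! : ℝ) + n * (Real.log 2 + Real.log n)) / Real.log (n ! : ℝ) -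
      (2 + (1 + Real.log 2) / Real.log n)| ≤ 24 / (Real.log n) ^ 2 := by
  have hnR : (2 : ℝ) ≤ n := by exact_mod_cast hn
  have hn0 : (0 : ℝ) < n := by linarith
  set L := Real.log n with hL
  have hLpos : 0 < L := Real.log_pos (by linarith)
  have hLn : L ≤ n := Real.log_le_self hn0.le
  have hLsq : L ^ 2 ≤ 4 * n := log_sq_le_four_mul (by linarith)
  have hc0 : 0 < Real.log 2 := Real.log_pos (by norm_num)
  have hc1 : Real.log 2 ≤ 1 := by linarith [Real.log_two_lt_d9]
  set c := Real.log 2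
  obtain ⟨ε, hε⟩ : ∃ ε, Real.log (n ! : ℝ) = n * (L - 1 + ε) :=
    ⟨Real.log (n ! : ℝ) / n - (L - 1), by field_simp; ring⟩
  have h1 := le_log_factorial (n := n) (by omega)
  have h2 := log_factorial_le (n := n) (by omega)
  have h3 := half_mul_log_le_log_factorial (n := n) (by omega)
  rw [hε, ← hL] at h1 h2 h3
  rw [hε]
  have hε0 : 0 ≤ n * ε := by linarith
  have hε0 : 0 ≤ ε := nonneg_of_mul_nonneg_right hε0 hn0
  have hε1 : n * ε ≤ L + 1 := by linarith
  have hD : L / 2 ≤ L - 1 + ε := by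
    refine le_of_mul_le_mul_left ?_ hn0
    linarith
  have hε2 : ε ≤ 2 := by
    refine le_of_mul_le_mul_left ?_ hn0
    linarith
  -- After multiplication by `n`: `n ε L ≤ L² + L ≤ 4n + n`.
  have hεL : ε * L ≤ 5 := by
    refine le_of_mul_le_mul_left ?_ hn0
    nlinarith
  obtain ⟨D, hDε⟩ : ∃ D, L - 1 + ε = D := ⟨_, rfl⟩
  rw [hDε] at hD ⊢
  have hDpos : 0 < D := by linarith
  have hnum : (n * D + n * (c + L)) / (n * D) - (2 + (1 + c) / L) =
      ((1 + c) * (1 - ε) - ε * L) / (D * L) := by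
    obtain rfl : ε = D - L + 1 := by linarith
    field_simp
    ring
  rw [hnum, abs_div, abs_of_pos (mul_pos hDpos hLpos), div_le_div_iff₀ (by positivity)
    (by positivity)]
  -- With `0 ≤ ε ≤ 2` and `c ≤ 1` the first term is at most 2 in absolute value and the second at
  -- most 5, so 12 is generous. The bound `D ≥ L / 2` then doubles it to 24.
  have habs : |(1 + c) * (1 - ε) - ε * L| ≤ 12 := by
    have : 0 ≤ ε * L := by positivity
    rw [abs_le]
    constructor <;> nlinarith
  calc |(1 + c) * (1 - ε) - ε * L| * L ^ 2 ≤ 12 * L ^ 2 := by gcongr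
    _ = 24 * (L / 2 * L) := by ring
    _ ≤ 24 * (D * L) := by gcongr

/-! ### The value of `γ` and the conclusion -/

theorem maxCharacterDegree_wreathGroup {n : ℕ} (hn : 1 ≤ n) :
    maxCharacterDegree (wreathGroup n) = n ! :=
  (isGreatest_characterDegrees hn).csSup_eq

theorem gammaExponent_wreathGroup {n : ℕ} (hn : 2 ≤ n) :
    gammaExponent (wreathGroup n) =
      ((Real.log (Nat.card (wreathGroup n)) / Real.log (n ! : ℝ) : ℝ) : EReal) := by
  rw [gammaExponent, if_neg (wreathGroup_not_comm hn),
    maxCharacterDegree_wreathGroup (by omega)]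

theorem log_card_wreathGroup {n : ℕ} (hn : 1 ≤ n) :
    Real.log (Nat.card (wreathGroup n)) =
      Real.log (n ! : ℝ) + n * (Real.log 2 + Real.log n) := by
  have hn0 : (0 : ℝ) < n := by exact_mod_cast hn
  rw [card_wreathGroup]
  push_cast
  rw [Real.log_mul (by positivity) (by positivity), Real.log_pow,
    Real.log_mul (by norm_num) hn0.ne']

theorem mainTheorem6 :
    (∀ n : ℕ, 1 ≤ n →
      (∃ H₁ H₂ H₃ : Subgroup (wreathGroup n),
        (H₁ : Set (wreathGroup n)) = {g | ∃ π : Equiv.Perm (Fin n), g = ⟨π, 0⟩} ∧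
        (H₂ : Set (wreathGroup n)) = {g | ∃ π : Equiv.Perm (Fin n),
          g = ⟨π, permuteCoords π (ascendingVec n) - ascendingVec n⟩} ∧
        (H₃ : Set (wreathGroup n)) = {g | ∃ π : Equiv.Perm (Fin n),
          g = ⟨π, permuteCoords π (descendingVec n) - descendingVec n⟩} ∧
        TripleProductProperty (H₁ : Set (wreathGroup n)) (H₂ : Set (wreathGroup n))
          (H₃ : Set (wreathGroup n))) ∧
      IsGreatest (characterDegrees (wreathGroup n)) n ! ∧
      ((pseudoExponent (wreathGroup n) : ℝ) : EReal) ≤ gammaExponent (wreathGroup n)) ∧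
    (∃ C : ℝ, ∀ n : ℕ, 2 ≤ n → ∃ γ : ℝ,
      gammaExponent (wreathGroup n) = (γ : EReal) ∧
      |γ - (2 + (1 + Real.log 2) / Real.log n)| ≤ C / (Real.log n) ^ 2) := by
  refine ⟨fun n hn => ⟨⟨WreathProduct.conjPerm 0, WreathProduct.conjPerm (ascendingVec n),
    WreathProduct.conjPerm (descendingVec n), ?_, rfl, rfl, tripleProductProperty_conjPerm n⟩,
    isGreatest_characterDegrees hn, ?_⟩, 24, fun n hn => ⟨_, gammaExponent_wreathGroup hn, ?_⟩⟩
  · have h (π : Equiv.Perm (Fin n)) :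
        permuteCoords π (0 : Fin n → ZMod (2 * n)) - 0 = 0 := sub_zero _
    simp only [WreathProduct.coe_conjPerm, h]
  -- For `n = 1` the group is abelian, so `γ = ∞` and the inequality is trivial.
  · rcases hn.eq_or_lt with rfl | hn
    · rw [gammaExponent, if_pos]
      · exact le_top
      · intro a b
        refine WreathProduct.ext (Subsingleton.elim _ _) (funext fun i => ?_)
        simp only [WreathProduct.mul_def, permuteCoords, Pi.add_apply,
          Subsingleton.elim (b.perm i) i, Subsingleton.elim (a.perm i) i]
        exact add_comm _ _
    · rw [gammaExponent_wreathGroup hn]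
      exact EReal.coe_le_coe_iff.mpr (pseudoExponent_wreathGroup_le hn)
  · rw [log_card_wreathGroup (by omega)]
    exact abs_log_div_log_factorial_sub_le hn
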